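/- Let $\widetilde{\ell}_2$ be the set of sequences $\mathbf{t}=(t_1,t_2,\ldots)$ of real numbers with $t_1\ge t_2\ge\cdots\ge 0$ and $|\mathbf{t}|_2:=\left(\sum_{k\ge 1}t_k^2\right)^{1/2}<\infty$. For $\mathbf{t}\in\widetilde{\ell}_2$ let $\mathcal{S}_{\mathbf{t}}:=\sum_{k=1}^\infty \mathcal{U}[-t_k/2,\,t_k/2]$ be the almost surely convergent sum of independent random variables, the $k$-th of which is uniformly distributed on $[-t_k/2,t_k/2]$ (and is $0$ if $t_k=0$). For a random variable $\mathcal{X}$ with mean $\mu$ and standard deviation $\sigma>0$ write $\mathcal{X}^*:=(\mathcal{X}-\mu)/\sigma$. Let $\mathcal{N}(0,\sigma^2)$ be a normal random variable (equal to $0$ if $\sigma=0$), independent of $\mathcal{S}_{\mathbf{t}}$. Identify random variables with their distributions, and put $$\mathbf{M}_{\mathrm{SUMS}}:=\{\mathcal{S}_{\mathbf{t}}^*:\mathbf{t}\in\widetilde{\ell}_2,\ \mathbf{t}\ne 0\},$$ $$\mathbf{M}_{\mathrm{DUSTPAN}}:=\{\mathcal{S}_{\mathbf{t}}+\mathcal{N}(0,\sigma^2):\mathbf{t}\in\widetilde{\ell}_2,\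 \sigma\ge 0,\ |\mathbf{t}|_2^2/12+\sigma^2=1\}.$$ Let closures be taken in the space of probability distributions on $\mathbb{R}$ with the Lévy metric $$L(\mu,\nu)=\inf\{\varepsilon>0: F_\mu(x-\varepsilon)-\varepsilon\le F_\nu(x)\le F_\mu(x+\varepsilon)+\varepsilon\ \text{ for all } x\in\mathbb{R}\},$$ where $F_\mu$ is the cumulative distribution function of $\mu$. Then $$\overline{\mathbf{M}_{\mathrm{SUMS}}}=\mathbf{M}_{\mathrm{DUSTPAN}} \qquad\text{and}\qquad \overline{\{\mathcal{S}_{\mathbf{t}}:\mathbf{t}\in\widetilde{\ell}_2,\ |\mathbf{t}|_2^2=12,\ \mathbf{t}\text{ has finite support}\}}=\mathbf{M}_{\mathrm{DUSTPAN}}.$$ -/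

import Mathlib

open MeasureTheory ProbabilityTheory Filter Topology

namespace Dustpan

noncomputable section

/-! ### The Lévy metric on distributions of real random variables -/

/-- The radii `ε` occurring in the definition of the Lévy distance: the distribution function of
`ν` lies between the two copies of that of `μ` moved diagonally by `ε`. -/
def levyRadii (μ ν : ProbabilityMeasure ℝ) : Set ℝ :=
  {ε : ℝ | 0 < ε ∧ ∀ x : ℝ,
    cdf (μ : Measure ℝ) (x - ε) - ε ≤ cdf (ν : Measure ℝ) x ∧
    cdf (ν : Measure ℝ) x ≤ cdf (μ : Measure ℝ) (x + ε) + ε}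

/-- The Lévy distance of two probability distributions on the line. -/
def levyDist (μ ν : ProbabilityMeasure ℝ) : ℝ := sInf (levyRadii μ ν)

theorem one_mem_levyRadii (μ ν : ProbabilityMeasure ℝ) : (1 : ℝ) ∈ levyRadii μ ν := by
  refine ⟨one_pos, fun x => ⟨?_, ?_⟩⟩
  · linarith [cdf_le_one (μ : Measure ℝ) (x - 1), cdf_nonneg (ν : Measure ℝ) x]
  · linarith [cdf_nonneg (μ : Measure ℝ) (x + 1), cdf_le_one (ν : Measure ℝ) x]

theorem levyRadii_bddBelow (μ ν : ProbabilityMeasure ℝ) : BddBelow (levyRadii μ ν) :=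
  ⟨0, fun _ h => h.1.le⟩

theorem levyDist_nonneg (μ ν : ProbabilityMeasure ℝ) : 0 ≤ levyDist μ ν :=
  Real.sInf_nonneg fun _ h => h.1.le

theorem levyRadii_symm {μ ν : ProbabilityMeasure ℝ} {ε : ℝ} (h : ε ∈ levyRadii μ ν) :
    ε ∈ levyRadii ν μ := by
  refine ⟨h.1, fun x => ⟨?_, ?_⟩⟩
  · have := (h.2 (x - ε)).2
    rw [sub_add_cancel] at this
    linarith
  · have := (h.2 (x + ε)).1
    rw [add_sub_cancel_right] at this
    linarith

theorem add_mem_levyRadii {μ ν κ : ProbabilityMeasure ℝ} {ε δ : ℝ} (h : ε ∈ levyRadii μ ν)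
    (h' : δ ∈ levyRadii ν κ) : ε + δ ∈ levyRadii μ κ := by
  refine ⟨add_pos h.1 h'.1, fun x => ⟨?_, ?_⟩⟩
  · have h1 := (h.2 (x - δ)).1
    have h2 := (h'.2 x).1
    rw [show x - δ - ε = x - (ε + δ) by ring] at h1
    linarith
  · have h1 := (h.2 (x + δ)).2
    have h2 := (h'.2 x).2
    rw [show x + δ + ε = x + (ε + δ) by ring] at h1
    linarith

theorem levyDist_self (μ : ProbabilityMeasure ℝ) : levyDist μ μ = 0 := by
  refine le_antisymm (le_of_forall_pos_le_add fun ε hε => ?_) (levyDist_nonneg μ μ)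
  rw [zero_add]
  refine csInf_le (levyRadii_bddBelow μ μ) ⟨hε, fun x => ⟨?_, ?_⟩⟩
  · linarith [monotone_cdf (μ : Measure ℝ) (show x - ε ≤ x by linarith)]
  · linarith [monotone_cdf (μ : Measure ℝ) (show x ≤ x + ε by linarith)]

theorem levyDist_comm (μ ν : ProbabilityMeasure ℝ) : levyDist μ ν = levyDist ν μ := by
  unfold levyDist
  congr 1
  ext ε
  exact ⟨levyRadii_symm, levyRadii_symm⟩

theorem levyDist_triangle (μ ν κ : ProbabilityMeasure ℝ) :
    levyDist μ κ ≤ levyDist μ ν + levyDist ν κ := by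
  rw [← sub_le_iff_le_add]
  refine le_csInf ⟨1, one_mem_levyRadii μ ν⟩ fun ε hε => ?_
  rw [sub_le_comm]
  refine le_csInf ⟨1, one_mem_levyRadii ν κ⟩ fun δ hδ => ?_
  rw [sub_le_iff_le_add']
  exact csInf_le (levyRadii_bddBelow μ κ) (add_mem_levyRadii hε hδ)

theorem cdf_le_of_levyDist_eq_zero {μ ν : ProbabilityMeasure ℝ} (h : levyDist μ ν = 0) (x : ℝ) :
    cdf (ν : Measure ℝ) x ≤ cdf (μ : Measure ℝ) x := by
  have hc : Tendsto (fun y => cdf (μ : Measure ℝ) y + (y - x)) (𝓝[>] x)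
      (𝓝 (cdf (μ : Measure ℝ) x + (x - x))) := by
    have h1 : Tendsto (cdf (μ : Measure ℝ)) (𝓝[>] x) (𝓝 (cdf (μ : Measure ℝ) x)) :=
      ((cdf (μ : Measure ℝ)).right_continuous x).mono_left
        (nhdsWithin_mono x Set.Ioi_subset_Ici_self)
    have h2 : Tendsto (fun y : ℝ => y - x) (𝓝[>] x) (𝓝 (x - x)) :=
      ((continuous_id.sub continuous_const).tendsto x).mono_left nhdsWithin_le_nhds
    exact h1.add h2
  rw [sub_self, add_zero] at hc
  refine ge_of_tendsto hc ?_
  filter_upwards [self_mem_nhdsWithin] with y hy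
  have hy' : levyDist μ ν < y - x := by rw [h]; exact sub_pos.2 hy
  obtain ⟨ε, hε, hlt⟩ := exists_lt_of_csInf_lt ⟨1, one_mem_levyRadii μ ν⟩ hy'
  have h1 := (hε.2 x).2
  have h2 := monotone_cdf (μ : Measure ℝ) (show x + ε ≤ y by linarith)
  linarith

/-- The space of distributions on the line as a metric space under the Lévy distance. -/
@[reducible] def levyMetric : MetricSpace (ProbabilityMeasure ℝ) where
  dist := levyDist
  dist_self := levyDist_self
  dist_comm := levyDist_comm
  dist_triangle := levyDist_triangle
  eq_of_dist_eq_zero := by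
    intro μ ν h
    have h' : levyDist ν μ = 0 := by rw [levyDist_comm]; exact h
    apply Subtype.ext
    have hμ : IsProbabilityMeasure (μ : Measure ℝ) := μ.2
    have hν : IsProbabilityMeasure (ν : Measure ℝ) := ν.2
    refine @Measure.eq_of_cdf (μ : Measure ℝ) (ν : Measure ℝ) hμ hν ?_
    ext x
    exact le_antisymm (cdf_le_of_levyDist_eq_zero h' x) (cdf_le_of_levyDist_eq_zero h x)

/-- The closure of a set of distributions in the topology of the Lévy metric. -/
def levyClosure (A : Set (ProbabilityMeasure ℝ)) : Set (ProbabilityMeasure ℝ) :=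
  @closure (ProbabilityMeasure ℝ) levyMetric.toUniformSpace.toTopologicalSpace A

/-! ### Decreasing sequences with finite 2-norm -/

/-- Weakly decreasing sequences of nonnegative reals with finite `2`-norm. The term written `t_k`
for `k = 1, 2, …` is `t (k - 1)` here. -/
def decSeq : Set (ℕ → ℝ) :=
  {t | Antitone t ∧ (∀ k, 0 ≤ t k) ∧ Summable fun k => t k ^ 2}

/-- The `2`-norm of a sequence. -/
def twoNorm (t : ℕ → ℝ) : ℝ := Real.sqrt (∑' k, t k ^ 2)

/-! ### Uniform sum distributions -/

/-- The continuous uniform distribution on `[a, b]`; a point mass if the interval is trivial. -/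
def uniformLaw (a b : ℝ) : Measure ℝ :=
  if a < b then cond volume (Set.Icc a b) else Measure.dirac a

instance uniformLaw_isProbabilityMeasure (a b : ℝ) : IsProbabilityMeasure (uniformLaw a b) := by
  unfold uniformLaw
  split_ifs with h
  · refine cond_isProbabilityMeasure_of_finite ?_ ?_
    · simp [Real.volume_Icc, h]
    · simp [Real.volume_Icc]
  · infer_instance

/-- The joint law of independent random variables `X₀, X₁, …` with `Xₖ` uniform on
`[-tₖ/2, tₖ/2]`; the variables themselves are the coordinates of `ℕ → ℝ`. -/
def jointUniform (t : ℕ → ℝ) : ProbabilityMeasure (ℕ → ℝ) :=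
  ⟨Measure.infinitePi fun k => uniformLaw (-(t k / 2)) (t k / 2), inferInstance⟩

/-- The value `X₀ + X₁ + ⋯` of the random series: the limit of the partial sums (wherever these
converge, which is almost everywhere under `jointUniform t` for square-summable `t`). -/
def seriesSum (x : ℕ → ℝ) : ℝ := limUnder atTop fun n => ∑ k ∈ Finset.range n, x k

theorem measurable_seriesSum : Measurable seriesSum := by
  have h : ∀ n : ℕ, StronglyMeasurable fun x : ℕ → ℝ => ∑ k ∈ Finset.range n, x k := fun n =>
    (Finset.measurable_fun_sum _ fun k _ => measurable_pi_apply k).stronglyMeasurable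
  exact (StronglyMeasurable.limUnder (l := atTop) h).measurable

/-- The distribution of the uniform sum random variable
`S_t = U[-t₁/2, t₁/2] + U[-t₂/2, t₂/2] + ⋯`, a sum of independent uniform variables. -/
def uniformSum (t : ℕ → ℝ) : ProbabilityMeasure ℝ :=
  (jointUniform t).map measurable_seriesSum.aemeasurable

/-- The distribution of `(X - E[X]) / √Var[X]` when `X` has distribution `μ`. -/
def standardize (μ : ProbabilityMeasure ℝ) : ProbabilityMeasure ℝ :=
  μ.map (f := fun x => (x - ∫ y, y ∂(μ : Measure ℝ)) / Real.sqrt (variance id (μ : Measure ℝ)))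
    ((measurable_id.sub_const _).div_const _).aemeasurable

/-- The distribution of `S_t + N(0, σ²)`, the two summands being independent. -/
def dustpan (t : ℕ → ℝ) (σ : ℝ) : ProbabilityMeasure ℝ :=
  ⟨(uniformSum t : Measure ℝ) ∗ gaussianReal 0 (Real.toNNReal (σ ^ 2)), inferInstance⟩

/-! ### The moduli spaces -/

/-- All standardized uniform sum distributions `S_t^*`. The zero sequence is left out: it gives the
point mass at `0`, the one case with variance `0`, which has no standardization. -/
def sumsModuli : Set (ProbabilityMeasure ℝ) :=
  {μ | ∃ t ∈ decSeq, t ≠ 0 ∧ μ = standardize (uniformSum t)}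

/-- The distributions `S_t` with `|t|₂² = 12` and `t` of finite support. -/
def finiteSumsModuli : Set (ProbabilityMeasure ℝ) :=
  {μ | ∃ t ∈ decSeq, twoNorm t ^ 2 = 12 ∧ (Function.support t).Finite ∧ μ = uniformSum t}

/-- The standardized DUSTPAN distributions. -/
def dustpanModuli : Set (ProbabilityMeasure ℝ) :=
  {μ | ∃ t ∈ decSeq, ∃ σ : ℝ, 0 ≤ σ ∧ twoNorm t ^ 2 / 12 + σ ^ 2 = 1 ∧ μ = dustpan t σ}

end

end Dustpan

namespace Dustpan

/-! ### The Lévy metric and weak convergence -/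

/-! Everything rests on one formula (`charFun_dustpan`). Pulling a Gaussian factor `exp (-x²/6)` out
of each `sinc x`, `x = t_k ξ / 2`, collects the exponent `|t|² ξ² / 24`; with the `σ² ξ² / 2` of the
normal part this totals `ξ² / 2` at unit variance. So the characteristic function is `exp (-ξ²/2) ∏
sincExp (t_k ξ / 2)`, in which `σ` no longer appears, and `sincExp x = 1 + O(x⁴)` for bounded `x`.

Since `t` decreases and `|t|² ≤ 12`, one has `t_k² ≤ 12 / (k + 1)`, so the factors differ from `1`
by a summable bound independent of `t`. Dominated convergence for products then shows that the law
depends continuously on `t` in the product topology, even when square mass escapes in the limit: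
that mass becomes Gaussian variance. The parameter space is compact for this topology, so its image
`dustpanModuli` is compact, hence closed.

Conversely, raising the first `n + 1` terms of `t` to a small common floor and dropping the rest
gives finite sequences with `|u|² = 12` that converge to `t` coordinatewise, so the finite sums are
dense. Standardized sums lie between finite sums and dustpan laws, which settles both closures.

The Lévy metric enters only through being Hausdorff and coarser than the weak topology. -/

/-- The Lévy condition is the Lévy–Prokhorov condition tested on half-lines only: the `ε`-thickening
of `(-∞, x]` lies in `(-∞, x + ε]`. -/
theorem mem_levyRadii_of_levyProkhorovEDist_lt {μ ν : ProbabilityMeasure ℝ} {ε : ℝ} (hε : 0 < ε)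
    (h : levyProkhorovEDist (μ : Measure ℝ) ν < ENNReal.ofReal ε) : ε ∈ levyRadii μ ν := by
  have key : ∀ {κ η : ProbabilityMeasure ℝ},
      levyProkhorovEDist (κ : Measure ℝ) η < ENNReal.ofReal ε →
      ∀ x, cdf (κ : Measure ℝ) x ≤ cdf (η : Measure ℝ) (x + ε) + ε := by
    intro κ η h x
    have h1 := left_measure_le_of_levyProkhorovEDist_lt h (measurableSet_Iic (a := x))
    rw [ENNReal.toReal_ofReal hε.le] at h1
    have h2 : Metric.thickening ε (Set.Iic x) ⊆ Set.Iic (x + ε) := by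
      intro y hy
      obtain ⟨z, hz, hd⟩ := Metric.mem_thickening_iff.1 hy
      rw [Real.dist_eq] at hd
      have := (abs_lt.1 hd).2
      simp only [Set.mem_Iic] at hz ⊢
      linarith
    have h3 := h1.trans (add_le_add_left (measure_mono h2) _)
    have h4 := ENNReal.toReal_mono (by finiteness) h3
    rw [ENNReal.toReal_add (by finiteness) (by finiteness), ENNReal.toReal_ofReal hε.le] at h4
    rwa [cdf_eq_real, cdf_eq_real]
  refine ⟨hε, fun x => ⟨?_, ?_⟩⟩
  · have := key h (x - ε)
    rw [sub_add_cancel] at this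
    linarith
  · exact key (by rwa [levyProkhorovEDist_comm]) x

theorem levyDist_le_levyProkhorovDist (μ ν : ProbabilityMeasure ℝ) :
    levyDist μ ν ≤ levyProkhorovDist (μ : Measure ℝ) ν := by
  refine le_of_forall_pos_le_add fun ε hε => csInf_le (levyRadii_bddBelow μ ν) ?_
  have h0 : 0 ≤ levyProkhorovDist (μ : Measure ℝ) ν := ENNReal.toReal_nonneg
  refine mem_levyRadii_of_levyProkhorovEDist_lt (by linarith) ?_
  rw [ENNReal.lt_ofReal_iff_toReal_lt (by simp)]
  change levyProkhorovDist (μ : Measure ℝ) ν < _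
  linarith

theorem weak_le_levy : (inferInstance : TopologicalSpace (ProbabilityMeasure ℝ)) ≤
    levyMetric.toUniformSpace.toTopologicalSpace := by
  rw [← continuous_id_iff_le, @continuous_iff_continuousAt]
  intro μ
  refine (@tendsto_iff_dist_tendsto_zero _ _ levyMetric.toPseudoMetricSpace _ _ _).2 ?_
  have h1 : Tendsto (fun ν : ProbabilityMeasure ℝ =>
      dist (LevyProkhorov.ofMeasure ν) (LevyProkhorov.ofMeasure μ)) (𝓝 μ) (𝓝 0) :=
    tendsto_iff_dist_tendsto_zero.1
      (LevyProkhorov.continuous_ofMeasure_probabilityMeasure.continuousAt (x := μ))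
  exact squeeze_zero (fun ν => levyDist_nonneg ν μ)
    (fun ν => levyDist_le_levyProkhorovDist ν μ) h1

theorem closure_subset_levyClosure (A : Set (ProbabilityMeasure ℝ)) :
    closure A ⊆ levyClosure A :=
  fun _ hμ => (@mem_closure_iff _ levyMetric.toUniformSpace.toTopologicalSpace _ _).2
    fun o ho hm => mem_closure_iff.1 hμ o (weak_le_levy o ho) hm

theorem levyClosure_mono {A B : Set (ProbabilityMeasure ℝ)} (h : A ⊆ B) :
    levyClosure A ⊆ levyClosure B :=
  @closure_mono _ levyMetric.toUniformSpace.toTopologicalSpace _ _ h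

/-- Weak compactness survives in the coarser Lévy topology, which is metric, so compact sets are
closed there. This is why the reverse comparison of topologies is never needed. -/
theorem levyClosure_eq_of_isCompact {A : Set (ProbabilityMeasure ℝ)} (hA : IsCompact A) :
    levyClosure A = A := by
  have h1 : @IsCompact _ levyMetric.toUniformSpace.toTopologicalSpace A := by
    have := @IsCompact.image _ _ _ levyMetric.toUniformSpace.toTopologicalSpace _ _ hA
      (continuous_id_iff_le.2 weak_le_levy)
    rwa [Set.image_id] at this
  exact @IsClosed.closure_eq _ levyMetric.toUniformSpace.toTopologicalSpace _
    (@IsCompact.isClosed _ levyMetric.toUniformSpace.toTopologicalSpace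
      (by let _ := levyMetric; infer_instance) _ h1)

/-! ### The normalized sine kernel -/

/-- The quotient of the characteristic functions of the uniform law on `[-1, 1]` and the centred
normal law with the same variance. -/
noncomputable def sincExp (x : ℝ) : ℝ := Real.sinc x * Real.exp (x ^ 2 / 6)

theorem continuous_sincExp : Continuous sincExp :=
  Real.continuous_sinc.mul (by fun_prop)

theorem abs_sinc_sub_le {x : ℝ} (hx : |x| ≤ 1) : |Real.sinc x - (1 - x ^ 2 / 6)| ≤ x ^ 4 / 100 := by
  rcases eq_or_ne x 0 with rfl | h0
  · simp
  have h := Real.sin_bound hx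
  have hpos : 0 < |x| := abs_pos.2 h0
  have e : Real.sin x - (x - x ^ 3 / 6) = x * (Real.sinc x - (1 - x ^ 2 / 6)) := by
    rw [Real.sinc_of_ne_zero h0]; field_simp
  rw [e, abs_mul] at h
  have e4 : x ^ 4 = |x| ^ 4 := (Even.pow_abs (by decide) x).symm
  rw [e4]
  refine le_of_mul_le_mul_left ?_ hpos
  calc _ ≤ |x| ^ 5 / 100 := h
    _ = _ := by ring

/-- Both `sinc x` and `exp (-x²/6)` are `1 - x²/6 + O(x⁴)`, so their quadratic terms cancel. For
`|x| ≥ 1` the trivial bound suffices because `x⁴ ≥ 1`. -/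
theorem abs_sincExp_sub_one_le {R x : ℝ} (hx : |x| ≤ R) :
    |sincExp x - 1| ≤ (1 + Real.exp (R ^ 2 / 6)) * x ^ 4 := by
  have hsq : x ^ 2 ≤ R ^ 2 := sq_le_sq' (abs_le.1 hx).1 (abs_le.1 hx).2
  have hexp : Real.exp (x ^ 2 / 6) ≤ Real.exp (R ^ 2 / 6) := Real.exp_le_exp.2 (by linarith)
  have hE : 0 < Real.exp (x ^ 2 / 6) := Real.exp_pos _
  have h4 : 0 ≤ x ^ 4 := by positivity
  rcases le_total |x| 1 with h1 | h1
  · have hx2 : x ^ 2 ≤ 1 := by rw [← sq_abs]; nlinarith [abs_nonneg x]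
    have a := abs_sinc_sub_le h1
    have b : |Real.exp (-(x ^ 2 / 6)) - 1 - -(x ^ 2 / 6)| ≤ (-(x ^ 2 / 6)) ^ 2 :=
      Real.abs_exp_sub_one_sub_id_le (by rw [abs_neg, abs_of_nonneg (by positivity)]; linarith)
    have e : sincExp x - 1 = Real.exp (x ^ 2 / 6) * ((Real.sinc x - (1 - x ^ 2 / 6)) -
        (Real.exp (-(x ^ 2 / 6)) - 1 - -(x ^ 2 / 6))) := by
      have := Real.exp_neg (x ^ 2 / 6)
      rw [this, sincExp]
      field_simp
      ring
    rw [e, abs_mul, abs_of_pos hE]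
    have c := abs_sub (Real.sinc x - (1 - x ^ 2 / 6)) (Real.exp (-(x ^ 2 / 6)) - 1 - -(x ^ 2 / 6))
    have d : |Real.sinc x - (1 - x ^ 2 / 6) - (Real.exp (-(x ^ 2 / 6)) - 1 - -(x ^ 2 / 6))| ≤
        x ^ 4 := by
      have : (-(x ^ 2 / 6)) ^ 2 = x ^ 4 / 36 := by ring
      linarith
    calc _ ≤ Real.exp (R ^ 2 / 6) * x ^ 4 := mul_le_mul hexp d (abs_nonneg _) (Real.exp_nonneg _)
      _ ≤ _ := by nlinarith
  · have h4' : 1 ≤ x ^ 4 := by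
      rw [← Even.pow_abs (by decide) x]
      exact one_le_pow₀ h1
    have a : |sincExp x| ≤ Real.exp (R ^ 2 / 6) := by
      rw [sincExp, abs_mul, abs_of_pos hE]
      calc _ ≤ 1 * Real.exp (x ^ 2 / 6) := by gcongr; exact Real.abs_sinc_le_one x
        _ ≤ _ := by linarith
    have b := abs_sub (sincExp x) 1
    rw [abs_one] at b
    have hR := Real.exp_pos (R ^ 2 / 6)
    nlinarith

/-! ### Centred uniform laws -/

theorem integral_uniformLaw {E : Type*} [NormedAddCommGroup E] [NormedSpace ℝ E] {u : ℝ}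
    (hu : 0 < u) (f : ℝ → E) :
    ∫ x, f x ∂(uniformLaw (-u) u) = (2 * u)⁻¹ • ∫ x in (-u)..u, f x := by
  have h : -u < u := by linarith
  rw [uniformLaw, if_pos h, ProbabilityTheory.cond, integral_smul_measure, Real.volume_Icc,
    integral_Icc_eq_integral_Ioc, intervalIntegral.integral_of_le h.le, ENNReal.toReal_inv,
    ENNReal.toReal_ofReal (by linarith)]
  congr 2
  ring

theorem uniformLaw_zero : uniformLaw (-0) 0 = Measure.dirac 0 := by
  simp [uniformLaw]

theorem ae_abs_le_uniformLaw {u : ℝ} (hu : 0 ≤ u) : ∀ᵐ x ∂(uniformLaw (-u) u), |x| ≤ u := by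
  rcases hu.eq_or_lt with rfl | h
  · rw [uniformLaw_zero, ae_dirac_iff (measurableSet_le (by fun_prop) (by fun_prop))]
    simp
  · rw [uniformLaw, if_pos (by linarith)]
    filter_upwards [ae_cond_mem (μ := volume) (s := Set.Icc (-u) u) measurableSet_Icc] with x hx
    exact abs_le.2 hx

theorem integral_id_uniformLaw {u : ℝ} (hu : 0 ≤ u) : ∫ x, x ∂(uniformLaw (-u) u) = 0 := by
  rcases hu.eq_or_lt with rfl | h
  · rw [uniformLaw_zero, integral_dirac]
  · rw [integral_uniformLaw h, integral_id]
    simp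

theorem integral_sq_uniformLaw {u : ℝ} (hu : 0 ≤ u) :
    ∫ x, x ^ 2 ∂(uniformLaw (-u) u) = u ^ 2 / 3 := by
  rcases hu.eq_or_lt with rfl | h
  · rw [uniformLaw_zero, integral_dirac]
    simp
  · rw [integral_uniformLaw h, integral_pow, smul_eq_mul]
    field_simp
    ring

theorem charFun_uniformLaw {u : ℝ} (hu : 0 ≤ u) (ξ : ℝ) :
    charFun (uniformLaw (-u) u) ξ = (Real.sinc (u * ξ) : ℂ) := by
  rcases hu.eq_or_lt with rfl | h
  · rw [uniformLaw_zero, charFun_dirac]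
    simp
  rcases eq_or_ne ξ 0 with rfl | hξ
  · simp
  have hξ' : (ξ : ℂ) ≠ 0 := by exact_mod_cast hξ
  have hu' : (u : ℂ) ≠ 0 := by exact_mod_cast h.ne'
  have hc : (ξ : ℂ) * Complex.I ≠ 0 := mul_ne_zero hξ' Complex.I_ne_zero
  rw [charFun_apply_real, integral_uniformLaw h]
  have e : ∀ x : ℝ, Complex.exp (ξ * x * Complex.I) = Complex.exp (ξ * Complex.I * x) := by
    intro x; ring_nf
  simp_rw [e]
  rw [integral_exp_mul_complex hc, Real.sinc_of_ne_zero (mul_ne_zero h.ne' hξ)]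
  push_cast
  rw [Complex.sin, Complex.real_smul]
  have e1 : (ξ : ℂ) * Complex.I * u = u * ξ * Complex.I := by ring
  have e2 : (ξ : ℂ) * Complex.I * -u = -(u * ξ) * Complex.I := by ring
  rw [e1, e2]
  push_cast
  field_simp
  rw [Complex.I_sq]
  ring

/-! ### Square-summable series of independent centred random variables -/

section IndependentSeries

variable {Ω : Type*} {mΩ : MeasurableSpace Ω} {P : Measure Ω}

theorem eLpNorm_two_eq_ofReal_sqrt {X : Ω → ℝ} (hX : MemLp X 2 P) :
    eLpNorm X 2 P = ENNReal.ofReal √(∫ ω, X ω ^ 2 ∂P) := by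
  rw [hX.eLpNorm_eq_integral_rpow_norm (by simp) (by simp), Real.sqrt_eq_rpow]
  simp

variable [IsProbabilityMeasure P] {X : ℕ → Ω → ℝ}

theorem integral_sum_sq_of_iIndepFun (hX : ∀ k, MemLp (X k) 2 P) (hi : iIndepFun X P)
    (h0 : ∀ k, ∫ ω, X k ω ∂P = 0) (s : Finset ℕ) :
    ∫ ω, (∑ k ∈ s, X k ω) ^ 2 ∂P = ∑ k ∈ s, ∫ ω, X k ω ^ 2 ∂P := by
  have hs : MemLp (∑ k ∈ s, X k) 2 P := memLp_finsetSum' s fun k _ => hX k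
  have h1 := IndepFun.variance_sum (s := s) (fun k _ => hX k)
    (fun i _ j _ hij => hi.indepFun hij)
  rw [variance_of_integral_eq_zero hs.aemeasurable] at h1
  · simp_rw [fun k => variance_of_integral_eq_zero (hX k).aemeasurable (h0 k)] at h1
    simpa using h1
  · simp only [Finset.sum_apply]
    rw [integral_finsetSum _ fun k _ => (hX k).integrable one_le_two]
    simp [h0]

/-- The sum at time `n` includes `X n`, because the natural filtration at time `n` already knows it.
-/
theorem martingale_sum_of_iIndepFun (hm : ∀ k, StronglyMeasurable (X k))
    (hX : ∀ k, Integrable (X k) P) (hi : iIndepFun X P) (h0 : ∀ k, ∫ ω, X k ω ∂P = 0) :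
    Martingale (fun n => ∑ k ∈ Finset.range (n + 1), X k) (Filtration.natural X hm) P := by
  refine martingale_of_condExp_sub_eq_zero_nat (fun n => ?_) (fun n => ?_) fun n => ?_
  · refine Finset.stronglyMeasurable_sum _ fun k hk => ?_
    exact (Filtration.stronglyAdapted_natural hm k).mono
      ((Filtration.natural X hm).mono (by simpa [Nat.lt_succ_iff] using hk))
  · exact integrable_finsetSum' _ fun k _ => hX k
  · rw [Finset.sum_range_succ _ (n + 1), add_sub_cancel_left]
    refine (hi.condExp_natural_ae_eq_of_lt hm n.lt_succ_self).trans ?_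
    simp only [h0]
    rfl

/-- The partial sums form a martingale bounded in L², hence in L¹, so martingale convergence
applies. -/
theorem ae_exists_tendsto_sum_of_iIndepFun (hm : ∀ k, StronglyMeasurable (X k))
    (hX : ∀ k, MemLp (X k) 2 P) (hi : iIndepFun X P) (h0 : ∀ k, ∫ ω, X k ω ∂P = 0)
    (hs : Summable fun k => ∫ ω, X k ω ^ 2 ∂P) :
    ∀ᵐ ω ∂P, ∃ c, Tendsto (fun n => ∑ k ∈ Finset.range n, X k ω) atTop (𝓝 c) := by
  have hM := martingale_sum_of_iIndepFun hm (fun k => (hX k).integrable one_le_two) hi h0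
  have hb : ∀ n, eLpNorm (∑ k ∈ Finset.range (n + 1), X k) 1 P ≤
      (√(∑' k, ∫ ω, X k ω ^ 2 ∂P)).toNNReal := fun n => by
    have hL : MemLp (∑ k ∈ Finset.range (n + 1), X k) 2 P := memLp_finsetSum' _ fun k _ => hX k
    refine (eLpNorm_le_eLpNorm_of_exponent_le one_le_two hL.1).trans ?_
    rw [eLpNorm_two_eq_ofReal_sqrt hL]
    refine ENNReal.ofReal_le_ofReal (Real.sqrt_le_sqrt ?_)
    simp only [Finset.sum_apply]
    rw [integral_sum_sq_of_iIndepFun hX hi h0]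
    exact hs.sum_le_tsum _ fun k _ => integral_nonneg fun ω => sq_nonneg _
  filter_upwards [hM.submartingale.exists_ae_tendsto_of_bdd hb] with ω hω
  obtain ⟨c, hc⟩ := hω
  refine ⟨c, (tendsto_add_atTop_iff_nat 1).1 ?_⟩
  simpa using hc

variable {S : Ω → ℝ}

/-- Fatou's lemma applied to the blocks from `n` to `m + n`, whose L² norms are computed by
orthogonality. -/
theorem eLpNorm_sum_sub_le_of_iIndepFun (hX : ∀ k, MemLp (X k) 2 P) (hi : iIndepFun X P)
    (h0 : ∀ k, ∫ ω, X k ω ∂P = 0) (hs : Summable fun k => ∫ ω, X k ω ^ 2 ∂P)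
    (hS : ∀ᵐ ω ∂P, Tendsto (fun n => ∑ k ∈ Finset.range n, X k ω) atTop (𝓝 (S ω))) (n : ℕ) :
    eLpNorm (fun ω => S ω - ∑ k ∈ Finset.range n, X k ω) 2 P ≤
      ENNReal.ofReal √(∑' k, ∫ ω, X (k + n) ω ^ 2 ∂P) := by
  have hL : ∀ s : Finset ℕ, MemLp (fun ω => ∑ k ∈ s, X k ω) 2 P :=
    fun s => memLp_finsetSum s fun k _ => hX k
  have hlim : ∀ᵐ ω ∂P, Tendsto (fun m => ∑ k ∈ Finset.Ico n (m + n), X k ω) atTop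
      (𝓝 (S ω - ∑ k ∈ Finset.range n, X k ω)) := by
    filter_upwards [hS] with ω hω
    refine (((tendsto_add_atTop_iff_nat n).2 hω).sub_const _).congr fun m => ?_
    rw [Finset.sum_Ico_eq_sub _ (Nat.le_add_left n m)]
  refine (Lp.eLpNorm_lim_le_liminf_eLpNorm (fun m => (hL (Finset.Ico n (m + n))).1) _ hlim).trans
    ?_
  refine (liminf_le_liminf (v := fun _ => ENNReal.ofReal √(∑' k, ∫ ω, X (k + n) ω ^ 2 ∂P))
    (Eventually.of_forall fun m => ?_)).trans (by simp)
  rw [eLpNorm_two_eq_ofReal_sqrt (hL _), integral_sum_sq_of_iIndepFun hX hi h0]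
  refine ENNReal.ofReal_le_ofReal (Real.sqrt_le_sqrt ?_)
  have hs' := (summable_nat_add_iff n).2 hs
  have e : ∑ k ∈ Finset.Ico n (m + n), ∫ ω, X k ω ^ 2 ∂P =
      ∑ k ∈ Finset.range m, ∫ ω, X (k + n) ω ^ 2 ∂P := by
    rw [Finset.sum_Ico_eq_sum_range, Nat.add_sub_cancel]
    simp_rw [add_comm n]
  rw [e]
  exact hs'.sum_le_tsum _ fun k _ => integral_nonneg fun ω => sq_nonneg _

theorem integral_and_integral_sq_of_ae_tendsto_sum (hX : ∀ k, MemLp (X k) 2 P)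
    (hi : iIndepFun X P) (h0 : ∀ k, ∫ ω, X k ω ∂P = 0)
    (hs : Summable fun k => ∫ ω, X k ω ^ 2 ∂P)
    (hS : ∀ᵐ ω ∂P, Tendsto (fun n => ∑ k ∈ Finset.range n, X k ω) atTop (𝓝 (S ω))) :
    ∫ ω, S ω ∂P = 0 ∧ ∫ ω, S ω ^ 2 ∂P = ∑' k, ∫ ω, X k ω ^ 2 ∂P := by
  set F : ℕ → Ω → ℝ := fun n ω => ∑ k ∈ Finset.range n, X k ω with hF
  have hL : ∀ n, MemLp (F n) 2 P := fun n => memLp_finsetSum _ fun k _ => hX k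
  have hSm : AEStronglyMeasurable S P := aestronglyMeasurable_of_tendsto_ae atTop
    (fun n => (hL n).1) hS
  have hle := eLpNorm_sum_sub_le_of_iIndepFun hX hi h0 hs hS
  -- With `n = 0` the tail estimate bounds the norm of `S` itself.
  have hSL : MemLp S 2 P := ⟨hSm, by
    have := hle 0
    simp only [Finset.range_zero, Finset.sum_empty, sub_zero] at this
    exact this.trans_lt ENNReal.ofReal_lt_top⟩
  have hconv : Tendsto (fun n => eLpNorm (F n - S) 2 P) atTop (𝓝 0) := by
    have h1 : Tendsto (fun n => ENNReal.ofReal √(∑' k, ∫ ω, X (k + n) ω ^ 2 ∂P)) atTop (𝓝 0) := by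
      have h2 := (tendsto_sum_nat_add fun k => ∫ ω, X k ω ^ 2 ∂P).sqrt
      rw [Real.sqrt_zero] at h2
      simpa using ENNReal.tendsto_ofReal h2
    refine tendsto_of_tendsto_of_tendsto_of_le_of_le tendsto_const_nhds h1 (fun _ => zero_le)
      fun n => ?_
    rw [eLpNorm_sub_comm]
    exact hle n
  constructor
  · have h1 : Tendsto (fun n => eLpNorm (F n - S) 1 P) atTop (𝓝 0) :=
      tendsto_of_tendsto_of_tendsto_of_le_of_le tendsto_const_nhds hconv (fun _ => zero_le)
        fun n => eLpNorm_le_eLpNorm_of_exponent_le one_le_two ((hL n).1.sub hSm)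
    have h2 := tendsto_integral_of_L1' S hSm
      (Eventually.of_forall fun n => (hL n).integrable one_le_two) h1
    refine tendsto_nhds_unique h2 (tendsto_const_nhds.congr fun n => ?_)
    rw [hF, integral_finsetSum _ fun k _ => (hX k).integrable one_le_two]
    simp [h0]
  · have h1 := ((Lp.tendsto_Lp_iff_tendsto_eLpNorm'' F hL S hSL).2 hconv).norm.pow 2
    have h2 : ∀ {Y : Ω → ℝ} (hY : MemLp Y 2 P), ‖hY.toLp Y‖ ^ 2 = ∫ ω, Y ω ^ 2 ∂P := by
      intro Y hY
      rw [Lp.norm_toLp, eLpNorm_two_eq_ofReal_sqrt hY, ENNReal.toReal_ofReal (Real.sqrt_nonneg _),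
        Real.sq_sqrt (integral_nonneg fun ω => sq_nonneg _)]
    simp_rw [h2] at h1
    refine tendsto_nhds_unique h1 (hs.hasSum.tendsto_sum_nat.congr fun n => ?_)
    exact (integral_sum_sq_of_iIndepFun hX hi h0 _).symm

end IndependentSeries

/-! ### Uniform sum distributions -/

section UniformSum

variable {t : ℕ → ℝ}

theorem integral_jointUniform_eval {E : Type*} [NormedAddCommGroup E] [NormedSpace ℝ E] (k : ℕ)
    {f : ℝ → E} (hf : Continuous f) :
    ∫ x, f (x k) ∂(jointUniform t : Measure (ℕ → ℝ)) =
      ∫ y, f y ∂(uniformLaw (-(t k / 2)) (t k / 2)) := by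
  have h := measurePreserving_eval_infinitePi (fun k => uniformLaw (-(t k / 2)) (t k / 2)) k
  rw [← h.map_eq, integral_map h.measurable.aemeasurable (by
    rw [h.map_eq]; exact hf.aestronglyMeasurable)]
  rfl

theorem iIndepFun_eval_jointUniform :
    iIndepFun (fun k (x : ℕ → ℝ) => x k) (jointUniform t : Measure (ℕ → ℝ)) :=
  iIndepFun_infinitePi (X := fun _ y => y) fun _ => measurable_id

theorem memLp_eval_jointUniform (ht : ∀ k, 0 ≤ t k) (k : ℕ) :
    MemLp (fun x : ℕ → ℝ => x k) 2 (jointUniform t : Measure (ℕ → ℝ)) := by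
  have h := measurePreserving_eval_infinitePi (fun k => uniformLaw (-(t k / 2)) (t k / 2)) k
  refine MemLp.of_bound (measurable_pi_apply k).aestronglyMeasurable (t k / 2) ?_
  exact h.quasiMeasurePreserving.ae (ae_abs_le_uniformLaw (by linarith [ht k]))

theorem integral_eval_jointUniform (ht : ∀ k, 0 ≤ t k) (k : ℕ) :
    ∫ x, x k ∂(jointUniform t : Measure (ℕ → ℝ)) = 0 := by
  rw [integral_jointUniform_eval (f := fun y => y) k continuous_id]
  exact integral_id_uniformLaw (by linarith [ht k])

theorem integral_eval_sq_jointUniform (ht : ∀ k, 0 ≤ t k) (k : ℕ) :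
    ∫ x, x k ^ 2 ∂(jointUniform t : Measure (ℕ → ℝ)) = t k ^ 2 / 12 := by
  rw [integral_jointUniform_eval (f := fun y => y ^ 2) k (by fun_prop),
    integral_sq_uniformLaw (by linarith [ht k])]
  ring

theorem ae_tendsto_seriesSum (ht : t ∈ decSeq) : ∀ᵐ x ∂(jointUniform t : Measure (ℕ → ℝ)),
    Tendsto (fun n => ∑ k ∈ Finset.range n, x k) atTop (𝓝 (seriesSum x)) := by
  have h := ae_exists_tendsto_sum_of_iIndepFun (P := (jointUniform t : Measure (ℕ → ℝ)))
    (fun k => (measurable_pi_apply k).stronglyMeasurable) (memLp_eval_jointUniform ht.2.1)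
    iIndepFun_eval_jointUniform (integral_eval_jointUniform ht.2.1)
    (by simp_rw [integral_eval_sq_jointUniform ht.2.1]; exact ht.2.2.div_const 12)
  filter_upwards [h] with x hx
  exact tendsto_nhds_limUnder hx

theorem twoNorm_sq (t : ℕ → ℝ) : twoNorm t ^ 2 = ∑' k, t k ^ 2 :=
  Real.sq_sqrt (tsum_nonneg fun _ => sq_nonneg _)

theorem integral_uniformSum (ht : t ∈ decSeq) : ∫ y, y ∂(uniformSum t : Measure ℝ) = 0 := by
  have h := integral_and_integral_sq_of_ae_tendsto_sum (memLp_eval_jointUniform ht.2.1)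
    iIndepFun_eval_jointUniform (integral_eval_jointUniform ht.2.1)
    (by simp_rw [integral_eval_sq_jointUniform ht.2.1]; exact ht.2.2.div_const 12)
    (ae_tendsto_seriesSum ht)
  rw [uniformSum, ProbabilityMeasure.toMeasure_map,
    integral_map measurable_seriesSum.aemeasurable (by fun_prop)]
  exact h.1

theorem variance_uniformSum (ht : t ∈ decSeq) :
    variance id (uniformSum t : Measure ℝ) = twoNorm t ^ 2 / 12 := by
  have h := integral_and_integral_sq_of_ae_tendsto_sum (memLp_eval_jointUniform ht.2.1)
    iIndepFun_eval_jointUniform (integral_eval_jointUniform ht.2.1)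
    (by simp_rw [integral_eval_sq_jointUniform ht.2.1]; exact ht.2.2.div_const 12)
    (ae_tendsto_seriesSum ht)
  rw [variance_of_integral_eq_zero aemeasurable_id (integral_uniformSum ht), uniformSum,
    ProbabilityMeasure.toMeasure_map,
    integral_map measurable_seriesSum.aemeasurable (by fun_prop)]
  simp only [id]
  rw [h.2, twoNorm_sq, ← tsum_div_const]
  exact tsum_congr (integral_eval_sq_jointUniform ht.2.1)

/-- Dominated convergence along the partial sums. Keeping a limit of finite products avoids any norm
bound on `t`, which matters for rescaling in `uniformSum_smul`. -/
theorem tendsto_prod_sinc_charFun (ht : t ∈ decSeq) (ξ : ℝ) :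
    Tendsto (fun n => ∏ k ∈ Finset.range n, (Real.sinc (t k / 2 * ξ) : ℂ)) atTop
      (𝓝 (charFun (uniformSum t : Measure ℝ) ξ)) := by
  have h1 : Tendsto (fun n => ∫ x, Complex.exp (ξ * (∑ k ∈ Finset.range n, x k : ℝ) * Complex.I)
        ∂(jointUniform t : Measure (ℕ → ℝ))) atTop
      (𝓝 (∫ x, Complex.exp (ξ * (seriesSum x : ℝ) * Complex.I)
        ∂(jointUniform t : Measure (ℕ → ℝ)))) := by
    refine tendsto_integral_of_dominated_convergence (fun _ => 1) (fun n => ?_)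
      (integrable_const _) (fun n => Eventually.of_forall fun x => ?_) ?_
    · exact (by fun_prop : Measurable fun x : ℕ → ℝ => Complex.exp
        (ξ * (∑ k ∈ Finset.range n, x k : ℝ) * Complex.I)).aestronglyMeasurable
    · rw [← Complex.ofReal_mul, Complex.norm_exp_ofReal_mul_I]
    · filter_upwards [ae_tendsto_seriesSum ht] with x hx
      exact ((by fun_prop : Continuous fun y : ℝ => Complex.exp (ξ * y * Complex.I)).tendsto
        _).comp hx
  have h2 : charFun (uniformSum t : Measure ℝ) ξ =
      ∫ x, Complex.exp (ξ * (seriesSum x : ℝ) * Complex.I)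
        ∂(jointUniform t : Measure (ℕ → ℝ)) := by
    rw [charFun_apply_real, uniformSum, ProbabilityMeasure.toMeasure_map,
      integral_map measurable_seriesSum.aemeasurable (by fun_prop)]
  rw [h2]
  refine h1.congr fun n => ?_
  have h3 := congrFun (iIndepFun.charFun_map_fun_finsetSum_eq_prod (s := Finset.range n)
    (X := fun k (x : ℕ → ℝ) => x k) (P := (jointUniform t : Measure (ℕ → ℝ)))
    (fun k _ => (measurable_pi_apply k).aemeasurable)
    (iIndepFun_eval_jointUniform.restrict _)) ξ
  rw [charFun_apply_real, integral_map (by fun_prop) (by fun_prop), Finset.prod_apply] at h3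
  rw [h3]
  refine Finset.prod_congr rfl fun k _ => ?_
  have h4 := measurePreserving_eval_infinitePi (fun k => uniformLaw (-(t k / 2)) (t k / 2)) k
  have h5 : charFun (Measure.map (fun x : ℕ → ℝ => x k) (jointUniform t : Measure (ℕ → ℝ))) ξ =
      charFun (uniformLaw (-(t k / 2)) (t k / 2)) ξ := congrArg (fun μ => charFun μ ξ) h4.map_eq
  rw [h5, charFun_uniformLaw (by linarith [ht.2.1 k])]

end UniformSum

/-! ### Characteristic functions of dustpan distributions -/

/-- Each of the first `k + 1` terms is at least `t k`. This is where monotonicity turns a norm bound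
into uniform decay. -/
theorem succ_mul_sq_le_twoNorm_sq {t : ℕ → ℝ} (ht : t ∈ decSeq) (k : ℕ) :
    (k + 1 : ℝ) * t k ^ 2 ≤ twoNorm t ^ 2 := by
  rw [twoNorm_sq]
  calc (k + 1 : ℝ) * t k ^ 2 = ∑ _i ∈ Finset.range (k + 1), t k ^ 2 := by simp
    _ ≤ ∑ i ∈ Finset.range (k + 1), t i ^ 2 := Finset.sum_le_sum fun i hi =>
        pow_le_pow_left₀ (ht.2.1 k) (ht.1 (Nat.lt_succ_iff.1 (Finset.mem_range.1 hi))) 2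
    _ ≤ _ := ht.2.2.sum_le_tsum _ fun i _ => sq_nonneg _

/-- A summable bound, uniform in `t`, for the deviations from `1` of the factors of
`charFun_dustpan`. -/
noncomputable def sincExpBound (ξ : ℝ) (k : ℕ) : ℝ :=
  (1 + Real.exp (3 * ξ ^ 2 / 6)) * (9 * ξ ^ 4) * (1 / (k + 1 : ℝ) ^ 2)

theorem summable_sincExpBound (ξ : ℝ) : Summable (sincExpBound ξ) := by
  refine Summable.mul_left _ ?_
  have h := (summable_nat_add_iff 1).2 (Real.summable_one_div_nat_pow.2 one_lt_two)
  exact h.congr fun k => by push_cast; rfl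

/-- The constants come from `t_k² ≤ 12`, giving `(t_k ξ / 2)² ≤ 3 ξ²` as the squared radius, and
from `t_k² ≤ 12 / (k + 1)`, giving `(t_k ξ / 2)⁴ ≤ 9 ξ⁴ / (k + 1)²`. -/
theorem abs_sincExp_sub_one_le_bound {t : ℕ → ℝ} (ht : t ∈ decSeq) (hn : twoNorm t ^ 2 ≤ 12)
    (ξ : ℝ) (k : ℕ) : |sincExp (t k / 2 * ξ) - 1| ≤ sincExpBound ξ k := by
  have h1 : (k + 1 : ℝ) * t k ^ 2 ≤ 12 := (succ_mul_sq_le_twoNorm_sq ht k).trans hn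
  have hk : (0 : ℝ) < k + 1 := by positivity
  have h2 : t k ^ 2 ≤ 12 / (k + 1) := by rwa [le_div_iff₀' hk]
  have h3 : t k ^ 2 ≤ 12 := by nlinarith [sq_nonneg (t k), (Nat.cast_nonneg k : (0 : ℝ) ≤ k)]
  have h4 : |t k / 2 * ξ| ≤ √(3 * ξ ^ 2) := by
    refine Real.abs_le_sqrt ?_
    nlinarith [sq_nonneg ξ]
  have h5 := abs_sincExp_sub_one_le h4
  rw [Real.sq_sqrt (by positivity)] at h5
  refine h5.trans ?_
  rw [sincExpBound, mul_assoc]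
  refine mul_le_mul_of_nonneg_left ?_ (by positivity)
  calc (t k / 2 * ξ) ^ 4 = (t k ^ 2) ^ 2 * (ξ ^ 4 / 16) := by ring
    _ ≤ (12 / (k + 1 : ℝ)) ^ 2 * (ξ ^ 4 / 16) := by gcongr
    _ = _ := by field_simp; ring

theorem multipliable_sincExp {t : ℕ → ℝ} (ht : t ∈ decSeq) (hn : twoNorm t ^ 2 ≤ 12) (ξ : ℝ) :
    Multipliable fun k => sincExp (t k / 2 * ξ) := by
  have h : Summable fun k => ‖sincExp (t k / 2 * ξ) - 1‖ :=
    (summable_sincExpBound ξ).of_nonneg_of_le (fun _ => norm_nonneg _)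
      (abs_sincExp_sub_one_le_bound ht hn ξ)
  simpa using multipliable_one_add_of_summable h

theorem prod_sinc_eq (x : ℕ → ℝ) (n : ℕ) :
    ∏ k ∈ Finset.range n, Real.sinc (x k) =
      (∏ k ∈ Finset.range n, sincExp (x k)) * Real.exp (-∑ k ∈ Finset.range n, x k ^ 2 / 6) := by
  rw [← Finset.sum_neg_distrib, Real.exp_sum, ← Finset.prod_mul_distrib]
  refine Finset.prod_congr rfl fun k _ => ?_
  rw [sincExp, mul_assoc, ← Real.exp_add, add_neg_cancel, Real.exp_zero, mul_one]

theorem charFun_uniformSum {t : ℕ → ℝ} (ht : t ∈ decSeq) (hn : twoNorm t ^ 2 ≤ 12) (ξ : ℝ) :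
    charFun (uniformSum t : Measure ℝ) ξ =
      ((∏' k, sincExp (t k / 2 * ξ)) * Real.exp (-(twoNorm t ^ 2 / 24 * ξ ^ 2)) : ℝ) := by
  refine tendsto_nhds_unique (tendsto_prod_sinc_charFun ht ξ) ?_
  have h1 := (multipliable_sincExp ht hn ξ).hasProd.tendsto_prod_nat
  have h2 : Tendsto (fun n => ∑ k ∈ Finset.range n, (t k / 2 * ξ) ^ 2 / 6) atTop
      (𝓝 (twoNorm t ^ 2 / 24 * ξ ^ 2)) := by
    rw [twoNorm_sq]
    refine (((ht.2.2.hasSum.div_const 24).mul_right (ξ ^ 2)).tendsto_sum_nat).congr fun n => ?_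
    exact Finset.sum_congr rfl fun k _ => by ring
  have h3 := h1.mul ((Real.continuous_exp.tendsto _).comp h2.neg)
  refine ((Complex.continuous_ofReal.tendsto _).comp h3).congr fun n => ?_
  simp only [Function.comp_apply]
  rw [← prod_sinc_eq, Complex.ofReal_prod]

theorem charFun_dustpan {t : ℕ → ℝ} (ht : t ∈ decSeq) {σ : ℝ}
    (hσ : twoNorm t ^ 2 / 12 + σ ^ 2 = 1) (ξ : ℝ) :
    charFun (dustpan t σ : Measure ℝ) ξ =
      ((∏' k, sincExp (t k / 2 * ξ)) * Real.exp (-(ξ ^ 2 / 2)) : ℝ) := by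
  have hn : twoNorm t ^ 2 ≤ 12 := by nlinarith [sq_nonneg σ]
  have h : (dustpan t σ : Measure ℝ) =
      (uniformSum t : Measure ℝ) ∗ gaussianReal 0 (Real.toNNReal (σ ^ 2)) := rfl
  rw [h, charFun_conv, charFun_uniformSum ht hn, charFun_gaussianReal]
  have e : (ξ : ℂ) * ((0 : ℝ) : ℂ) * Complex.I -
      ((Real.toNNReal (σ ^ 2) : NNReal) : ℂ) * (ξ : ℂ) ^ 2 / 2 = ((-(σ ^ 2 * ξ ^ 2 / 2) : ℝ) : ℂ) := by
    have : ((Real.toNNReal (σ ^ 2) : NNReal) : ℂ) = ((σ ^ 2 : ℝ) : ℂ) := by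
      exact congrArg Complex.ofReal (Real.coe_toNNReal _ (sq_nonneg σ))
    rw [this]
    push_cast
    ring
  rw [e, ← Complex.ofReal_exp, ← Complex.ofReal_mul, mul_assoc, ← Real.exp_add]
  congr 3
  have : twoNorm t ^ 2 = 12 * (1 - σ ^ 2) := by linarith
  rw [this]
  ring

/-! ### Compactness of the dustpan moduli space -/

/-- The decreasing sequences of `2`-norm at most `√12`. -/
def dustpanParams : Set (ℕ → ℝ) :=
  {t | Antitone t ∧ (∀ k, 0 ≤ t k) ∧ ∀ n, ∑ k ∈ Finset.range n, t k ^ 2 ≤ 12}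

/-- Bounding partial sums instead of the whole series makes each constraint depend on finitely many
coordinates, hence closed in the product topology. -/
theorem mem_dustpanParams_iff {t : ℕ → ℝ} :
    t ∈ dustpanParams ↔ t ∈ decSeq ∧ twoNorm t ^ 2 ≤ 12 := by
  rw [twoNorm_sq]
  constructor
  · rintro ⟨h1, h2, h3⟩
    have hs := summable_of_sum_range_le (fun k => sq_nonneg (t k)) h3
    exact ⟨⟨h1, h2, hs⟩, hs.tsum_le_of_sum_range_le h3⟩
  · rintro ⟨⟨h1, h2, h3⟩, h4⟩
    exact ⟨h1, h2, fun n => (h3.sum_le_tsum _ fun k _ => sq_nonneg _).trans h4⟩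

theorem isCompact_dustpanParams : IsCompact dustpanParams := by
  have hcl : IsClosed dustpanParams := by
    simp only [dustpanParams, Antitone, Set.ofPred_and, Set.ofPred_forall]
    refine IsClosed.inter ?_ (IsClosed.inter ?_ ?_)
    · exact isClosed_iInter fun i => isClosed_iInter fun j => isClosed_iInter fun _ =>
        isClosed_le (continuous_apply _) (continuous_apply _)
    · exact isClosed_iInter fun i => isClosed_le continuous_const (continuous_apply _)
    · exact isClosed_iInter fun n => isClosed_le (by fun_prop) continuous_const
  refine (isCompact_univ_pi fun _ : ℕ => isCompact_Icc (a := (0 : ℝ)) (b := √12)).of_isClosed_subset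
    hcl fun t ht k _ => ⟨ht.2.1 k, Real.le_sqrt_of_sq_le ?_⟩
  have h := ht.2.2 (k + 1)
  rw [Finset.sum_range_succ] at h
  have h' : 0 ≤ ∑ i ∈ Finset.range k, t i ^ 2 := Finset.sum_nonneg fun i _ => sq_nonneg _
  linarith

/-- The dustpan distribution of variance `1` with uniform part given by `t`. -/
noncomputable def unitDustpan (t : ℕ → ℝ) : ProbabilityMeasure ℝ :=
  dustpan t √(1 - twoNorm t ^ 2 / 12)

theorem charFun_unitDustpan {t : ℕ → ℝ} (ht : t ∈ dustpanParams) (ξ : ℝ) :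
    charFun (unitDustpan t : Measure ℝ) ξ =
      ((∏' k, sincExp (t k / 2 * ξ)) * Real.exp (-(ξ ^ 2 / 2)) : ℝ) := by
  obtain ⟨h1, h2⟩ := mem_dustpanParams_iff.1 ht
  refine charFun_dustpan h1 ?_ ξ
  rw [Real.sq_sqrt (by linarith)]
  ring

/-- Coordinatewise convergence is enough: the norms of `u n` need not converge to that of `t`, since
the formula for the characteristic function does not see them. -/
theorem tendsto_unitDustpan {u : ℕ → ℕ → ℝ} {t : ℕ → ℝ} (hu : ∀ n, u n ∈ dustpanParams)
    (ht : t ∈ dustpanParams) (h : Tendsto u atTop (𝓝 t)) :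
    Tendsto (fun n => unitDustpan (u n)) atTop (𝓝 (unitDustpan t)) := by
  refine ProbabilityMeasure.tendsto_of_tendsto_charFun fun ξ => ?_
  simp_rw [fun n => charFun_unitDustpan (hu n) ξ]
  rw [charFun_unitDustpan ht]
  refine (Complex.continuous_ofReal.tendsto _).comp (Tendsto.mul_const _ ?_)
  have h1 := tendsto_tprod_one_add_of_dominated_convergence (𝓕 := atTop)
    (f := fun n k => sincExp (u n k / 2 * ξ) - 1) (g := fun k => sincExp (t k / 2 * ξ) - 1)
    (summable_sincExpBound ξ) (fun k => ?_) (Eventually.of_forall fun n k => ?_)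
  · simpa using h1
  · refine Tendsto.sub_const ?_ 1
    exact (continuous_sincExp.tendsto _).comp
      (((tendsto_pi_nhds.1 h k).div_const 2).mul_const ξ)
  · obtain ⟨h2, h3⟩ := mem_dustpanParams_iff.1 (hu n)
    exact abs_sincExp_sub_one_le_bound h2 h3 ξ k

theorem image_unitDustpan : unitDustpan '' dustpanParams = dustpanModuli := by
  ext μ
  constructor
  · rintro ⟨t, ht, rfl⟩
    obtain ⟨h1, h2⟩ := mem_dustpanParams_iff.1 ht
    refine ⟨t, h1, _, Real.sqrt_nonneg _, ?_, rfl⟩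
    rw [Real.sq_sqrt (by linarith)]
    ring
  · rintro ⟨t, ht, σ, h0, hσ, rfl⟩
    refine ⟨t, mem_dustpanParams_iff.2 ⟨ht, by nlinarith [sq_nonneg σ]⟩, ?_⟩
    rw [unitDustpan, ← hσ, add_sub_cancel_left, Real.sqrt_sq h0]

theorem isCompact_dustpanModuli : IsCompact dustpanModuli := by
  rw [← image_unitDustpan]
  refine isCompact_dustpanParams.image_of_continuousOn ?_
  rw [continuousOn_iff_continuous_domRestrict]
  -- Sequences suffice because the countable product `ℕ → ℝ` is first countable.
  refine SeqContinuous.continuous fun u t h => ?_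
  exact tendsto_unitDustpan (fun n => (u n).2) t.2 ((continuous_subtype_val.tendsto t).comp h)

/-! ### Density of finite uniform sums -/

/-- Intermediate value theorem in the floor `s`: at `s = 0` the sum is at most `12`, and at `s = 4`
a single term already contributes `16`. -/
theorem exists_truncation {t : ℕ → ℝ} (ht : t ∈ dustpanParams) {n : ℕ} (hn : 0 < n) :
    ∃ s : ℝ, 0 ≤ s ∧ ∑ k ∈ Finset.range n, max (t k) s ^ 2 = 12 := by
  have hc : ContinuousOn (fun s => ∑ k ∈ Finset.range n, max (t k) s ^ 2) (Set.Icc 0 4) := by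
    fun_prop
  have h0 : ∑ k ∈ Finset.range n, max (t k) 0 ^ 2 ≤ 12 := by
    simp_rw [fun k => max_eq_left (ht.2.1 k)]
    exact ht.2.2 n
  have h4 : (12 : ℝ) ≤ ∑ k ∈ Finset.range n, max (t k) 4 ^ 2 := by
    have h1 := Finset.single_le_sum (f := fun k => max (t k) 4 ^ 2)
      (fun k _ => sq_nonneg _) (Finset.mem_range.2 hn)
    have h2 : (4 : ℝ) ≤ max (t 0) 4 := le_max_right _ _
    nlinarith
  obtain ⟨s, hs, he⟩ := intermediate_value_Icc (by norm_num : (0 : ℝ) ≤ 4) hc ⟨h0, h4⟩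
  exact ⟨s, hs.1, he⟩

theorem dustpan_zero_right (t : ℕ → ℝ) : dustpan t 0 = uniformSum t := by
  apply Subtype.ext
  change (uniformSum t : Measure ℝ) ∗ gaussianReal 0 (Real.toNNReal (0 ^ 2)) = uniformSum t
  simp [gaussianReal_zero_var]

theorem unitDustpan_of_twoNorm_sq {t : ℕ → ℝ} (h : twoNorm t ^ 2 = 12) :
    unitDustpan t = uniformSum t := by
  rw [unitDustpan, h, ← dustpan_zero_right]
  norm_num

/-- The missing variance is supplied by many small equal terms at the floor level, which play the
role of the Gaussian part in the limit. -/
theorem dustpanModuli_subset_closure : dustpanModuli ⊆ closure finiteSumsModuli := by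
  rw [← image_unitDustpan]
  rintro _ ⟨t, ht, rfl⟩
  choose s hs0 hs using fun n : ℕ => exists_truncation ht n.succ_pos
  set u : ℕ → ℕ → ℝ := fun n k => if k < n + 1 then max (t k) (s n) else 0 with hu
  have hsq : ∀ n, HasSum (fun k => u n k ^ 2) 12 := fun n => by
    have h1 : HasSum (fun k => u n k ^ 2) (∑ k ∈ Finset.range (n + 1), u n k ^ 2) := by
      refine hasSum_sum_of_ne_finset_zero fun k hk => ?_
      simp only [hu, if_neg (by simpa using hk : ¬ k < n + 1)]
      norm_num
    have h2 : ∑ k ∈ Finset.range (n + 1), u n k ^ 2 = 12 := by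
      rw [← hs n]
      refine Finset.sum_congr rfl fun k hk => ?_
      simp only [hu, if_pos (Finset.mem_range.1 hk)]
    rwa [h2] at h1
  have hnorm : ∀ n, twoNorm (u n) ^ 2 = 12 := fun n => by rw [twoNorm_sq, (hsq n).tsum_eq]
  have hdec : ∀ n, u n ∈ decSeq := fun n => by
    refine ⟨fun i j hij => ?_, fun k => ?_, (hsq n).summable⟩
    · have h1 : 0 ≤ max (t i) (s n) := le_max_of_le_right (hs0 n)
      have h2 : max (t j) (s n) ≤ max (t i) (s n) := max_le_max_right _ (ht.1 hij)
      simp only [hu]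
      split_ifs <;> first | exact h2 | exact h1 | omega | exact le_rfl
    · simp only [hu]
      split_ifs
      · exact le_max_of_le_right (hs0 n)
      · exact le_rfl
  have hs_lim : Tendsto s atTop (𝓝 0) := by
    -- All `n + 1` terms are at least `s n`, while their squares sum to `12`.
    have h1 : ∀ n, s n ≤ √(12 / ((n : ℝ) + 1)) := fun n => by
      refine Real.le_sqrt_of_sq_le ?_
      rw [le_div_iff₀ (by positivity), ← hs n]
      calc s n ^ 2 * ((n : ℝ) + 1) = ∑ _k ∈ Finset.range (n + 1), s n ^ 2 := by
            simp [mul_comm]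
        _ ≤ _ := Finset.sum_le_sum fun k _ => pow_le_pow_left₀ (hs0 n) (le_max_right _ _) 2
    have h2 : Tendsto (fun n : ℕ => 12 / ((n : ℝ) + 1)) atTop (𝓝 0) := by
      have := (tendsto_one_div_add_atTop_nhds_zero_nat (𝕜 := ℝ)).const_mul 12
      simpa [div_eq_mul_inv] using this
    have h3 := h2.sqrt
    rw [Real.sqrt_zero] at h3
    exact squeeze_zero hs0 h1 h3
  have hlim : Tendsto u atTop (𝓝 t) := by
    refine tendsto_pi_nhds.2 fun k => ?_
    have h1 : Tendsto (fun n => max (t k) (s n)) atTop (𝓝 (max (t k) 0)) :=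
      tendsto_const_nhds.max hs_lim
    rw [max_eq_left (ht.2.1 k)] at h1
    refine h1.congr' ?_
    filter_upwards [eventually_ge_atTop k] with n hn
    simp only [hu, if_pos (Nat.lt_succ_of_le hn)]
  refine mem_closure_of_tendsto (tendsto_unitDustpan
    (fun n => mem_dustpanParams_iff.2 ⟨hdec n, (hnorm n).le⟩) ht hlim)
    (Eventually.of_forall fun n => ⟨u n, hdec n, hnorm n, ?_, unitDustpan_of_twoNorm_sq (hnorm n)⟩)
  refine (Finset.range (n + 1)).finite_toSet.subset fun k hk => ?_
  by_contra hlt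
  exact hk (if_neg (by simpa using hlt))

/-! ### Standardization of uniform sums -/

theorem smul_mem_decSeq {t : ℕ → ℝ} (ht : t ∈ decSeq) {c : ℝ} (hc : 0 ≤ c) : c • t ∈ decSeq :=
  ⟨fun _ _ hij => mul_le_mul_of_nonneg_left (ht.1 hij) hc, fun k => mul_nonneg hc (ht.2.1 k),
    (ht.2.2.mul_left (c ^ 2)).congr fun k => (mul_pow c (t k) 2).symm⟩

theorem twoNorm_smul_sq (t : ℕ → ℝ) (c : ℝ) : twoNorm (c • t) ^ 2 = c ^ 2 * twoNorm t ^ 2 := by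
  simp_rw [twoNorm_sq, Pi.smul_apply, smul_eq_mul, mul_pow, tsum_mul_left]

theorem twoNorm_sq_pos {t : ℕ → ℝ} (ht : t ∈ decSeq) (h0 : t ≠ 0) : 0 < twoNorm t ^ 2 := by
  obtain ⟨k, hk⟩ := Function.ne_iff.1 h0
  rw [twoNorm_sq]
  exact ht.2.2.tsum_pos (fun k => sq_nonneg _) k (pow_pos ((ht.2.1 k).lt_of_ne' hk) 2)

/-- Compared through characteristic functions, since scaling `t` by `c` has the same effect on each
sinc factor as scaling `ξ`. -/
theorem uniformSum_smul {t : ℕ → ℝ} (ht : t ∈ decSeq) {c : ℝ} (hc : 0 ≤ c) :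
    (uniformSum (c • t) : Measure ℝ) = (uniformSum t : Measure ℝ).map (c * ·) := by
  have := Measure.isProbabilityMeasure_map (μ := (uniformSum t : Measure ℝ))
    (measurable_const_mul c).aemeasurable
  refine Measure.ext_of_charFun (funext fun ξ => ?_)
  rw [charFun_map_mul]
  refine tendsto_nhds_unique (tendsto_prod_sinc_charFun (smul_mem_decSeq ht hc) ξ)
    ((tendsto_prod_sinc_charFun ht (c * ξ)).congr fun n => ?_)
  refine Finset.prod_congr rfl fun k _ => ?_
  rw [Pi.smul_apply, smul_eq_mul]
  congr 2
  ring

theorem standardize_uniformSum {t : ℕ → ℝ} (ht : t ∈ decSeq) :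
    standardize (uniformSum t) = uniformSum ((√(twoNorm t ^ 2 / 12))⁻¹ • t) := by
  have h : (standardize (uniformSum t) : Measure ℝ) = (uniformSum t : Measure ℝ).map
      fun x => (x - ∫ y, y ∂(uniformSum t : Measure ℝ)) /
        √(variance id (uniformSum t : Measure ℝ)) := ProbabilityMeasure.toMeasure_map _ _
  refine Subtype.ext (h.trans ?_)
  rw [integral_uniformSum ht, variance_uniformSum ht]
  refine Eq.trans ?_ (uniformSum_smul ht (inv_nonneg.2 (Real.sqrt_nonneg _))).symm
  congr 1
  ext x
  rw [sub_zero, div_eq_inv_mul]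

theorem finiteSumsModuli_subset_sumsModuli : finiteSumsModuli ⊆ sumsModuli := by
  rintro _ ⟨t, ht, hn, -, rfl⟩
  refine ⟨t, ht, ?_, ?_⟩
  · rintro rfl
    rw [twoNorm_sq] at hn
    simp at hn
  · rw [standardize_uniformSum ht, hn]
    norm_num

theorem sumsModuli_subset_dustpanModuli : sumsModuli ⊆ dustpanModuli := by
  rintro _ ⟨t, ht, h0, rfl⟩
  refine ⟨_, smul_mem_decSeq ht (inv_nonneg.2 (Real.sqrt_nonneg (twoNorm t ^ 2 / 12))), 0, le_rfl,
    ?_, (standardize_uniformSum ht).trans (dustpan_zero_right _).symm⟩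
  have h := twoNorm_sq_pos ht h0
  rw [twoNorm_smul_sq, inv_pow, Real.sq_sqrt (by positivity), inv_div, div_mul_cancel₀ _ h.ne']
  norm_num

end Dustpan

theorem corollary1p10 :
    Dustpan.levyClosure Dustpan.sumsModuli = Dustpan.dustpanModuli ∧
    Dustpan.levyClosure Dustpan.finiteSumsModuli = Dustpan.dustpanModuli := by
  have hle : Dustpan.levyClosure Dustpan.sumsModuli ⊆ Dustpan.dustpanModuli :=
    (Dustpan.levyClosure_mono Dustpan.sumsModuli_subset_dustpanModuli).trans
      (Dustpan.levyClosure_eq_of_isCompact Dustpan.isCompact_dustpanModuli).subset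
  have hfin : Dustpan.levyClosure Dustpan.finiteSumsModuli ⊆
      Dustpan.levyClosure Dustpan.sumsModuli :=
    Dustpan.levyClosure_mono Dustpan.finiteSumsModuli_subset_sumsModuli
  have hge : Dustpan.dustpanModuli ⊆ Dustpan.levyClosure Dustpan.finiteSumsModuli :=
    Dustpan.dustpanModuli_subset_closure.trans (Dustpan.closure_subset_levyClosure _)
  exact ⟨hle.antisymm (hge.trans hfin), (hfin.trans hle).antisymm hge⟩
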